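/- Let $\mathcal C$ be a small category with a Grothendieck topology and let $X$ be an object of $\mathcal C$. A map $F\to G$ of simplicial presheaves on $\mathcal C$ is a \emph{local acyclic fibration} if it is both a local fibration and a local weak equivalence. Here $F\to G$ is a local fibration if, for every object $Y$, every square from $\Lambda^{n,k}\otimes Y\to\Delta^n\otimes Y$ ($n\ge 1$, $0\le k\le n$) to $F\to G$ has a lifting after restriction to each member $Z\to Y$ of some covering sieve of $Y$. A map between locally fibrant simplicial presheaves is a local weak equivalence if every square from $\partial\Delta^n\otimes Y\to\Delta^n\otimes Y$ ($n\ge 0$) to $F\to G$ has, after restriction to each member $Z\to Y$ of some covering sieve of $Y$, a relative homotopy-lifting $\Delta^n\otimes Z\to F$: the upper triangle commutes, and the lower triangle commutes up to simplicial homotopy relative to $\partial\Delta^n\otimes Z$. A \emph{hypercover} of $X$ is a simplicial presheaf $U$ on $\mathcal C$ with an augmentation $U\to X$ to the (discrete) representable presheaf of $X$, such that each presheaf $U_n$ is a coproduct of representable presheaves and $U\to X$ is a local acyclic fibration. Let $\pi HC_X$ be the category whose objects are the hypercovers of $X$ and whose morphisms from $U$ to $V$ are the maps $U\to V$ of simplicial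 presheaves over $X$, modulo the equivalence relation generated by simplicial homotopies $\Delta^1\otimes U\to V$. Then $\pi HC_X$ is filtered, in the sense appropriate for colimits over $(\pi HC_X)^{op}$ (that is, $\pi HC_X$ is cofiltered): it is non-empty; for any two objects $U,V$ there are an object $W$ and morphisms $W\to U$ and $W\to V$; and for any two parallel morphisms $V\rightrightarrows U$ there is a morphism $W\to V$ whose composites with the two morphisms are equal. -/

import Mathlib

universe u

open CategoryTheory Opposite Limits MonoidalCategory CartesianMonoidalCategory Simplicial

namespace CategoryTheory

/-- The category `sPre(C)` of simplicial presheaves on a small category `C`. -/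
abbrev SimplicialPresheaf (C : Type u) [SmallCategory C] : Type (u + 1) :=
  Cᵒᵖ ⥤ SSet.{u}

namespace SimplicialPresheaf

variable {C : Type u} [SmallCategory C]

/-- The presheaf of sets `Fₙ` of `n`-simplices of a simplicial presheaf `F`. -/
abbrev level (F : SimplicialPresheaf C) (n : ℕ) : Cᵒᵖ ⥤ Type u :=
  F ⋙ SSet.evaluation.obj (op ⦋n⦌)

/-- The representable simplicial presheaf `rX`: its value at `Y` is the discrete simplicial set
`Hom(Y, X)`. -/
abbrev representable (X : C) : SimplicialPresheaf C :=
  yoneda.obj X ⋙ SimplicialObject.const (Type u)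

/-- The presheaf of sets `P` is a coproduct (possibly empty) of a family of representable
presheaves. -/
def IsCoproductOfRepresentables (P : Cᵒᵖ ⥤ Type u) : Prop :=
  ∃ (ι : Type u) (A : ι → C), Nonempty (P ≅ ∐ fun i => yoneda.obj (A i))

/-- `F ⟶ G` is a local fibration: it has local liftings with respect to the horn inclusions
`Λ[n, k] ⊗ rY ⟶ Δ[n] ⊗ rY`, for all `n ≥ 1`, all `0 ≤ k ≤ n` and all `Y`. A morphism
`K ⊗ rY ⟶ F` is the same thing as a morphism of simplicial sets `K ⟶ F(Y)`. The liftings over the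
various members of the covering sieve need not be compatible. -/
def IsLocalFibration (J : GrothendieckTopology C) {F G : SimplicialPresheaf C} (p : F ⟶ G) :
    Prop :=
  ∀ (n : ℕ) (k : Fin (n + 2)) (Y : C)
    (a : (Λ[n + 1, k] : SSet.{u}) ⟶ F.obj (op Y)) (b : Δ[n + 1] ⟶ G.obj (op Y)),
    a ≫ p.app (op Y) = (SSet.horn.{u} (n + 1) k).ι ≫ b →
    ∃ R ∈ J Y, ∀ ⦃Z : C⦄ (f : Z ⟶ Y), R f →
      ∃ l : Δ[n + 1] ⟶ F.obj (op Z),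
        (SSet.horn.{u} (n + 1) k).ι ≫ l = a ≫ F.map f.op ∧
        l ≫ p.app (op Z) = b ≫ G.map f.op

/-- Two maps `s t : L ⟶ K` of simplicial sets are joined by a simplicial homotopy
`L × Δ[1] ⟶ K` relative to the subcomplex `A` of `L`. -/
def RelHomotopic {L K : SSet.{u}} (A : L.Subcomplex) (s t : L ⟶ K) : Prop :=
  ∃ H : L ⊗ Δ[1] ⟶ K,
    SSet.ι₀ ≫ H = s ∧ SSet.ι₁ ≫ H = t ∧ A.ι ▷ Δ[1] ≫ H = fst _ _ ≫ A.ι ≫ t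

/-- `F ⟶ G` is a local weak equivalence (a notion used here for maps between locally fibrant
simplicial presheaves): every square from `∂Δ[n] ⊗ rY ⟶ Δ[n] ⊗ rY` to `F ⟶ G` has, after
restriction to the members of a covering sieve of `Y`, relative homotopy-liftings `Δ[n] ⊗ rZ ⟶ F`:
the upper triangle commutes, the lower one commutes up to simplicial homotopy relative to
`∂Δ[n] ⊗ rZ`. -/
def IsLocalWeakEquivalence (J : GrothendieckTopology C) {F G : SimplicialPresheaf C}
    (p : F ⟶ G) : Prop :=
  ∀ (n : ℕ) (Y : C) (a : (∂Δ[n] : SSet.{u}) ⟶ F.obj (op Y)) (b : Δ[n] ⟶ G.obj (op Y)),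
    a ≫ p.app (op Y) = (SSet.boundary.{u} n).ι ≫ b →
    ∃ R ∈ J Y, ∀ ⦃Z : C⦄ (f : Z ⟶ Y), R f →
      ∃ l : Δ[n] ⟶ F.obj (op Z),
        (SSet.boundary.{u} n).ι ≫ l = a ≫ F.map f.op ∧
        RelHomotopic (SSet.boundary.{u} n) (l ≫ p.app (op Z)) (b ≫ G.map f.op)

/-- A local acyclic fibration is a map that is both a local fibration and a local weak
equivalence. (A local fibration with locally fibrant target has locally fibrant source. The target
below is a representable, hence discrete, hence locally fibrant.) -/
def IsLocalAcyclicFibration (J : GrothendieckTopology C) {F G : SimplicialPresheaf C}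
    (p : F ⟶ G) : Prop :=
  IsLocalFibration J p ∧ IsLocalWeakEquivalence J p

/-- An augmented simplicial presheaf `U ⟶ rX` is a hypercover of `X` if each `Uₙ` is a coproduct of
representables and `U ⟶ rX` is a local acyclic fibration. -/
def isHypercover (J : GrothendieckTopology C) (X : C) : ObjectProperty (Over (representable X)) :=
  fun U => (∀ n : ℕ, IsCoproductOfRepresentables (U.left.level n)) ∧
    IsLocalAcyclicFibration J U.hom

/-- The category `HC_X` of hypercovers of `X` and maps of simplicial presheaves over `X`. -/
abbrev HC (J : GrothendieckTopology C) (X : C) : Type (u + 1) :=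
  (isHypercover J X).FullSubcategory

/-- The simplicial presheaf `K ⊗ F`, given objectwise by the product (here `F(Y) × K`). -/
abbrev tensor (F : SimplicialPresheaf C) (K : SSet.{u}) : SimplicialPresheaf C :=
  F ⋙ tensorRight K

/-- The inclusion of `F` in `Δ[1] ⊗ F` at the vertex `0`. -/
noncomputable def incl₀ (F : SimplicialPresheaf C) : F ⟶ F.tensor Δ[1] where
  app _ := SSet.ι₀
  naturality _ _ f := (SSet.ι₀_comp (F.map f)).symm

/-- The inclusion of `F` in `Δ[1] ⊗ F` at the vertex `1`. -/
noncomputable def incl₁ (F : SimplicialPresheaf C) : F ⟶ F.tensor Δ[1] where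
  app _ := SSet.ι₁
  naturality _ _ f := (SSet.ι₁_comp (F.map f)).symm

/-- There is a simplicial homotopy `Δ[1] ⊗ F ⟶ G` from `s` to `t`. -/
def SimplicialHomotopic {F G : SimplicialPresheaf C} (s t : F ⟶ G) : Prop :=
  ∃ H : F.tensor Δ[1] ⟶ G, F.incl₀ ≫ H = s ∧ F.incl₁ ≫ H = t

/-- The relation of simplicial homotopy on the maps between hypercovers of `X`. (A simplicial
homotopy between two maps over `X` is itself over `X`, because `rX` is discrete.) -/
def homotopyRel (J : GrothendieckTopology C) (X : C) : HomRel (HC J X) :=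
  fun _ _ s t => SimplicialHomotopic s.hom.left t.hom.left

/-- Simplicial homotopy is stable under composition, so that the morphisms of the quotient category
by `homotopyRel` are the classes for the equivalence relation generated by it. -/
instance (J : GrothendieckTopology C) (X : C) :
    (homotopyRel J X).IsStableUnderPrecomp where
  comp_left {U V W} f {g g'} := by
    rintro ⟨H, h₀, h₁⟩
    refine ⟨Functor.whiskerRight f.hom.left (tensorRight Δ[1]) ≫ H, ?_, ?_⟩
    · exact congrArg (f.hom.left ≫ ·) h₀
    · exact congrArg (f.hom.left ≫ ·) h₁

instance (J : GrothendieckTopology C) (X : C) :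
    (homotopyRel J X).IsStableUnderPostcomp where
  comp_right {U V W} f f' g := by
    rintro ⟨H, h₀, h₁⟩
    exact ⟨H ≫ g.hom.left, congrArg (· ≫ g.hom.left) h₀, congrArg (· ≫ g.hom.left) h₁⟩

/-- The category `πHC_X`: its objects are the hypercovers of `X`, its morphisms are the maps over
`X` modulo the equivalence relation generated by simplicial homotopy. -/
abbrev PiHC (J : GrothendieckTopology C) (X : C) : Type (u + 1) :=
  CategoryTheory.Quotient (homotopyRel J X)

end SimplicialPresheaf

end CategoryTheory

/-! Call a map locally trivial if it lifts locally, on the nose, against every `∂Δ[n] ⟶ Δ[n]`. As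
`rX` is discrete, homotopies into it are constant, so for maps to `rX` this is the same as being a
local acyclic fibration (`isLocalAcyclicFibration_iff`). Locally trivial maps are stable under
composition and base change, and lift locally against every mono with finite target
(`hasLocalLifting_of_mono`).

The condition on representables can be repaired afterwards. Every `F` receives a locally trivial map
from `freeResolution F`, which is levelwise a coproduct of representables: a cell is freely attached
for each boundary and each simplex of `F` filling its image.

It therefore suffices to find locally trivial maps to `rX`: the identity, the fibre product of `U`
and `V` over `rX`, and, for `s t : V ⟶ U`, the object of homotopies `V ×_{U × U} U^Δ[1]`. The last
one is locally trivial over `V`, because lifting `∂Δ[n] ⟶ Δ[n]` against its projection amounts to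
lifting `∂Δ[n] × Δ[1] ∪ Δ[n] × ∂Δ[1] ⟶ Δ[n] × Δ[1]` against `U ⟶ rX`. Over it, `s` and `t` are
tautologically homotopic. -/

namespace CategoryTheory.SimplicialPresheaf

variable {C : Type u} [SmallCategory C]

/-! ### The free resolution of a simplicial presheaf -/

/-- Raw simplices of the free resolution of `F`: the restriction along `f : Z ⟶ A` of the
degeneracy along `s` of a cell, which is given by a boundary `a` and a simplex `b` of `F(A)`. -/
inductive PreCell (F : SimplicialPresheaf C) : SimplexCategory → C → Type u where
  | mk (n : SimplexCategory) (A : C)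
      (a : ∀ (k : SimplexCategory) (τ : k ⟶ n), ¬ Epi τ → PreCell F k A)
      (b : (F.obj (op A)).obj (op n)) {m : SimplexCategory} {Z : C}
      (s : m ⟶ n) (hs : Epi s) (f : Z ⟶ A) : PreCell F m Z

namespace PreCell

variable {F : SimplicialPresheaf C} {m m' m'' : SimplexCategory} {Z Z' Z'' : C}

/-- Restriction of a raw simplex along a morphism of `C`. -/
def pull (g : Z' ⟶ Z) (r : PreCell F m Z) : PreCell F m Z' :=
  match r with
  | mk n A a b s hs f => mk n A a b s hs (g ≫ f)

open Classical in
/-- The action of a morphism of the simplex category on a raw simplex. -/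
noncomputable def act (θ : m' ⟶ m) (r : PreCell F m Z) : PreCell F m' Z :=
  match r with
  | mk _ _ a b s _ f =>
    -- The boundary is recorded on all non-surjective maps, not only on faces, so no epi-mono
    -- factorization of `θ ≫ s` is needed.
    if h : Epi (θ ≫ s) then mk _ _ a b (θ ≫ s) h f else (a _ (θ ≫ s) h).pull f

/-- The image of a raw simplex in `F`. -/
def val (r : PreCell F m Z) : (F.obj (op Z)).obj (op m) :=
  match r with
  | mk _ _ _ b s _ f => (F.map f.op).app _ ((F.obj _).map s.op b)

/-- The faces of a cell have to be compatible, and to lie over the faces of its image in `F`. -/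
def WF {m : SimplexCategory} {Z : C} (r : PreCell F m Z) : Prop :=
  match r with
  | mk n _ a b _ _ _ =>
    (∀ k τ h, (a k τ h).WF) ∧
    (∀ k k' (τ : k ⟶ n) (θ : k' ⟶ k) h h', a k' (θ ≫ τ) h' = (a k τ h).act θ) ∧
    (∀ k (τ : k ⟶ n) h, (a k τ h).val = (F.obj _).map τ.op b)

@[simp]
lemma pull_id (r : PreCell F m Z) : r.pull (𝟙 Z) = r := by
  cases r; simp [pull]

@[simp]
lemma pull_pull (g : Z' ⟶ Z) (g' : Z'' ⟶ Z') (r : PreCell F m Z) :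
    (r.pull g).pull g' = r.pull (g' ≫ g) := by
  cases r; simp [pull]

lemma act_mk_of_epi {n : SimplexCategory} {A : C}
    (a : ∀ (k : SimplexCategory) (τ : k ⟶ n), ¬ Epi τ → PreCell F k A)
    (b : (F.obj (op A)).obj (op n)) (s : m ⟶ n) (hs : Epi s) (f : Z ⟶ A) (θ : m' ⟶ m)
    (h : Epi (θ ≫ s)) : (mk n A a b s hs f).act θ = mk n A a b (θ ≫ s) h f :=
  dif_pos h

lemma act_mk_of_not_epi {n : SimplexCategory} {A : C}
    (a : ∀ (k : SimplexCategory) (τ : k ⟶ n), ¬ Epi τ → PreCell F k A)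
    (b : (F.obj (op A)).obj (op n)) (s : m ⟶ n) (hs : Epi s) (f : Z ⟶ A) (θ : m' ⟶ m)
    (h : ¬ Epi (θ ≫ s)) : (mk n A a b s hs f).act θ = (a _ (θ ≫ s) h).pull f :=
  dif_neg h

@[simp]
lemma act_id (r : PreCell F m Z) : r.act (𝟙 m) = r := by
  obtain ⟨n, A, a, b, s, hs, f⟩ := r
  rw [act_mk_of_epi _ _ _ _ _ _ (by simpa)]
  simp

lemma act_pull (g : Z' ⟶ Z) (θ : m' ⟶ m) (r : PreCell F m Z) :
    (r.pull g).act θ = (r.act θ).pull g := by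
  obtain ⟨n, A, a, b, s, hs, f⟩ := r
  by_cases h : Epi (θ ≫ s)
  · rw [act_mk_of_epi _ _ _ _ _ _ h, pull, act_mk_of_epi _ _ _ _ _ _ h, pull]
  · rw [act_mk_of_not_epi _ _ _ _ _ _ h, pull, act_mk_of_not_epi _ _ _ _ _ _ h, pull_pull]

lemma val_pull (g : Z' ⟶ Z) (r : PreCell F m Z) :
    (r.pull g).val = (F.map g.op).app _ r.val := by
  cases r; simp [pull, val]

lemma WF.pull {r : PreCell F m Z} (hr : r.WF) (g : Z' ⟶ Z) : (r.pull g).WF := by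
  cases r; simpa only [PreCell.pull, WF] using hr

lemma WF.act {r : PreCell F m Z} (hr : r.WF) (θ : m' ⟶ m) : (r.act θ).WF := by
  obtain ⟨n, A, a, b, s, hs, f⟩ := r
  by_cases h : Epi (θ ≫ s)
  · rw [act_mk_of_epi _ _ _ _ _ _ h]
    simpa only [WF] using hr
  · rw [act_mk_of_not_epi _ _ _ _ _ _ h]
    simp only [WF] at hr
    exact (hr.1 _ _ _).pull _

/-- The case with content is `θ ≫ s` not epi: then neither is `θ' ≫ θ ≫ s`, and the claim is the
compatibility of the faces of the cell. -/
lemma WF.act_act {r : PreCell F m Z} (hr : r.WF) (θ : m' ⟶ m) (θ' : m'' ⟶ m') :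
    (r.act θ).act θ' = r.act (θ' ≫ θ) := by
  obtain ⟨n, A, a, b, s, hs, f⟩ := r
  by_cases h : Epi (θ ≫ s)
  · rw [act_mk_of_epi _ _ _ _ _ _ h]
    by_cases h' : Epi (θ' ≫ θ ≫ s)
    · rw [act_mk_of_epi _ _ _ _ _ _ h', act_mk_of_epi _ _ _ _ _ _ (by simpa)]
      simp
    · rw [act_mk_of_not_epi _ _ _ _ _ _ h', act_mk_of_not_epi _ _ _ _ _ _ (by simpa)]
      simp
  · have h' : ¬ Epi (θ' ≫ θ ≫ s) := fun _ ↦ h (epi_of_epi θ' _)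
    simp only [WF] at hr
    rw [act_mk_of_not_epi _ _ _ _ _ _ h, act_mk_of_not_epi _ _ _ _ _ _ (by simpa), act_pull,
      ← hr.2.1 _ _ _ _ _ h']
    simp

lemma WF.val_act {r : PreCell F m Z} (hr : r.WF) (θ : m' ⟶ m) :
    (r.act θ).val = (F.obj _).map θ.op r.val := by
  obtain ⟨n, A, a, b, s, hs, f⟩ := r
  by_cases h : Epi (θ ≫ s)
  · rw [act_mk_of_epi _ _ _ _ _ _ h]
    simp [val]
  · simp only [WF] at hr
    rw [act_mk_of_not_epi _ _ _ _ _ _ h, val_pull, hr.2.2]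
    simp [val]

end PreCell

/-- A simplicial presheaf which is levelwise a coproduct of representables, with a map to `F`
which has the right lifting property with respect to all `∂Δ[n] ⊗ rY ⟶ Δ[n] ⊗ rY`. -/
@[simps]
noncomputable def freeResolution (F : SimplicialPresheaf C) : SimplicialPresheaf C where
  obj Z :=
    { obj m := { r : PreCell F m.unop Z.unop // r.WF }
      map θ := TypeCat.ofHom fun r ↦ ⟨r.1.act θ.unop, r.2.act _⟩
      map_id _ := by ext; simp
      map_comp _ _ := by ext r; simp [r.2.act_act] }
  map g := { app m := TypeCat.ofHom fun r ↦ ⟨r.1.pull g.unop, r.2.pull _⟩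
             naturality _ _ _ := by ext; simp [PreCell.act_pull] }
  map_id _ := by ext; simp
  map_comp _ _ := by ext; simp

/-- The projection from the free resolution. -/
@[simps]
noncomputable def freeResolutionπ (F : SimplicialPresheaf C) : F.freeResolution ⟶ F where
  app Z := { app m := TypeCat.ofHom fun r ↦ r.1.val
             naturality _ _ _ := by ext r; exact r.2.val_act _ }
  naturality _ _ _ := by ext _ r; exact PreCell.val_pull _ r.1

lemma freeResolutionπ_lift (F : SimplicialPresheaf C) (n : ℕ) (Y : C)
    (a : (∂Δ[n] : SSet.{u}) ⟶ F.freeResolution.obj (op Y)) (b : Δ[n] ⟶ F.obj (op Y))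
    (sq : a ≫ F.freeResolutionπ.app (op Y) = (SSet.boundary.{u} n).ι ≫ b) :
    ∃ l : Δ[n] ⟶ F.freeResolution.obj (op Y),
      (SSet.boundary.{u} n).ι ≫ l = a ∧ l ≫ F.freeResolutionπ.app (op Y) = b := by
  have mem (k : SimplexCategory) (τ : k ⟶ ⦋n⦌) (h : ¬ Epi τ) :
      SSet.stdSimplex.objEquiv.{u}.symm τ ∈ (SSet.boundary.{u} n).obj (op k) := by
    rw [SimplexCategory.epi_iff_surjective] at h
    exact h
  -- The lift is the free cell attached to the lifting problem itself, undegenerated and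
  -- unrestricted.
  let r : PreCell F ⦋n⦌ Y := .mk ⦋n⦌ Y (fun k τ h ↦ (a.app (op k) ⟨_, mem k τ h⟩).1)
    (SSet.yonedaEquiv b) (𝟙 _) inferInstance (𝟙 _)
  have hr : r.WF := by
    refine ⟨fun k τ h ↦ (a.app (op k) ⟨_, mem k τ h⟩).2, fun k k' τ θ h h' ↦ ?_,
      fun k τ h ↦ ?_⟩
    · exact congrArg Subtype.val (NatTrans.naturality_apply a θ.op ⟨_, mem k τ h⟩)
    · refine (ConcreteCategory.congr_hom (NatTrans.congr_app sq (op k)) ⟨_, mem k τ h⟩).trans ?_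
      obtain ⟨y, rfl⟩ := SSet.yonedaEquiv.symm.surjective b
      rw [Equiv.apply_symm_apply]
      exact SSet.yonedaEquiv_symm_app_objEquiv_symm y τ
  refine ⟨SSet.yonedaEquiv.symm ⟨r, hr⟩, ?_, ?_⟩
  · ext k ⟨x, hx⟩
    obtain ⟨τ, rfl⟩ := SSet.stdSimplex.objEquiv.symm.surjective x
    have h : ¬ Epi (τ ≫ 𝟙 ⦋n⦌) := by
      rw [SimplexCategory.epi_iff_surjective, Category.comp_id]
      exact hx
    have h₁ : r.act τ = (a.app k ⟨_, hx⟩).1 := by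
      -- The action evaluates the boundary at `τ ≫ 𝟙`; the proof of non-surjectivity depends on this
      -- map, so it is generalized before being replaced by `τ`.
      have key (τ' : k.unop ⟶ ⦋n⦌) (hτ : τ' = τ) (h' : ¬ Epi τ') :
          (a.app k ⟨_, mem k.unop τ' h'⟩).1 = (a.app k ⟨_, hx⟩).1 := by
        subst hτ
        rfl
      rw [PreCell.act_mk_of_not_epi _ _ _ _ _ _ h, PreCell.pull_id]
      exact key _ (Category.comp_id _) h
    exact (SSet.yonedaEquiv_symm_app_objEquiv_symm
      (X := F.freeResolution.obj (op Y)) ⟨r, hr⟩ τ).trans (Subtype.ext h₁)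
  · apply SSet.yonedaEquiv.injective
    rw [SSet.yonedaEquiv_comp]
    refine (congrArg ((F.freeResolutionπ.app (op Y)).app (op ⦋n⦌))
      (SSet.yonedaEquiv.apply_symm_apply (⟨r, hr⟩ : F.freeResolution.obj (op Y) _⦋n⦌))).trans ?_
    change r.val = _
    simp [r, PreCell.val]

/-- By Yoneda the `x i` form a cofan, and the hypothesis makes it bijective on sections; uniqueness
gives the naturality of the descent maps. -/
lemma isCoproductOfRepresentables_of_bijective {P : Cᵒᵖ ⥤ Type u} {ι : Type u} (A : ι → C)
    (x : ∀ i, P.obj (op (A i)))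
    (h : ∀ (Z : C) (y : P.obj (op Z)), ∃! p : Σ i, (Z ⟶ A i), P.map p.2.op (x p.1) = y) :
    IsCoproductOfRepresentables P := by
  choose q hq hq' using h
  let c : Cofan (fun i ↦ yoneda.obj (A i)) := Cofan.mk P (fun i ↦ yonedaEquiv.symm (x i))
  let φ (s : Cofan (fun i ↦ yoneda.obj (A i))) (Z : C) (p : Σ i, (Z ⟶ A i)) :
    s.pt.obj (op Z) := (s.inj p.1).app (op Z) p.2
  have hc : IsColimit c := Cofan.IsColimit.mk _
    (fun s ↦
      { app Z := TypeCat.ofHom fun y ↦ φ s Z.unop (q Z.unop y)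
        naturality Z Z' f := by
          ext y
          have : q Z'.unop (P.map f y) = ⟨(q Z.unop y).1, f.unop ≫ (q Z.unop y).2⟩ :=
            (hq' _ _ _ (by
              have := hq Z.unop y
              dsimp at this ⊢
              rw [Functor.map_comp_apply, this])).symm
          refine (congrArg (φ s Z'.unop) this).trans ?_
          exact NatTrans.naturality_apply (s.inj (q Z.unop y).1) f (q Z.unop y).2 })
    (fun s i ↦ by
      ext Z f
      exact congrArg (φ s Z.unop) (hq' _ (P.map f.op (x i)) ⟨i, f⟩ rfl).symm)
    (fun s m hm ↦ by
      ext Z y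
      obtain ⟨p, rfl⟩ : ∃ p : Σ i, (Z.unop ⟶ A i), P.map p.2.op (x p.1) = y := ⟨_, hq _ _⟩
      refine Eq.trans ?_ (congrArg (φ s Z.unop) (hq' _ _ p rfl))
      simp only [φ, ← hm]
      rfl)
  exact ⟨ι, A, ⟨hc.coconePointUniqueUpToIso (coproductIsCoproduct _)⟩⟩

/-- At a fixed level, restriction changes only the component `f`, by precomposition. The simplices
with `f = 𝟙`, degenerate ones included, are thus free generators. -/
lemma isCoproductOfRepresentables_freeResolution (F : SimplicialPresheaf C) (n : ℕ) :
    IsCoproductOfRepresentables (F.freeResolution.level n) := by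
  let ι : Type u := { p : Σ A : C, PreCell F ⦋n⦌ A // p.2.WF ∧
    ∃ k a b s hs, p.2 = .mk k p.1 a b s hs (𝟙 _) }
  refine isCoproductOfRepresentables_of_bijective (ι := ι) (fun i ↦ i.1.1)
    (fun i ↦ ⟨i.1.2, i.2.1⟩) ?_
  rintro Z ⟨⟨k, A, a, b, s, hs, f⟩, hy⟩
  refine ⟨⟨⟨⟨A, .mk k A a b s hs (𝟙 _)⟩, hy, k, a, b, s, hs, rfl⟩, f⟩, ?_, ?_⟩
  · apply Subtype.ext
    change (PreCell.mk k A a b s hs (𝟙 _)).pull f = _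
    simp [PreCell.pull]
  · rintro ⟨⟨⟨A', r⟩, hr, hr'⟩, f'⟩ h
    have hr'' := hr'
    obtain ⟨k', a', b', s', hs', e⟩ := hr''
    dsimp only at f' e
    replace h : r.pull f' = .mk k A a b s hs f := congrArg Subtype.val h
    rw [e, PreCell.pull, Category.comp_id] at h
    cases h
    subst e
    rfl

/-! ### Local liftings and locally trivial fibrations -/

/-- `p` has local liftings with respect to the maps `i ⊗ rY`, for all `Y`. -/
def HasLocalLifting (J : GrothendieckTopology C) {A B : SSet.{u}} (i : A ⟶ B)
    {F G : SimplicialPresheaf C} (p : F ⟶ G) : Prop :=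
  ∀ (Y : C) (a : A ⟶ F.obj (op Y)) (b : B ⟶ G.obj (op Y)), a ≫ p.app (op Y) = i ≫ b →
    ∃ R ∈ J Y, ∀ ⦃Z : C⦄ (f : Z ⟶ Y), R f →
      ∃ l : B ⟶ F.obj (op Z), i ≫ l = a ≫ F.map f.op ∧ l ≫ p.app (op Z) = b ≫ G.map f.op

/-- `p` has local liftings with respect to all boundary inclusions. -/
def IsLocalTrivialFibration (J : GrothendieckTopology C) {F G : SimplicialPresheaf C}
    (p : F ⟶ G) : Prop :=
  ∀ n : ℕ, HasLocalLifting J (SSet.boundary.{u} n).ι p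

namespace HasLocalLifting

variable {J : GrothendieckTopology C} {F G H : SimplicialPresheaf C} {p : F ⟶ G}
  {A B A' B' : SSet.{u}}

lemma of_isIso (i : A ⟶ B) [IsIso i] : HasLocalLifting J i p := by
  intro Y a b h
  refine ⟨⊤, J.top_mem _, fun Z f _ ↦ ⟨inv i ≫ a ≫ F.map f.op, by simp, ?_⟩⟩
  simp [← reassoc_of% h]

lemma comp_left {i : A ⟶ B} {j : B ⟶ B'} (hi : HasLocalLifting J i p)
    (hj : HasLocalLifting J j p) : HasLocalLifting J (i ≫ j) p := by
  intro Y a b h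
  obtain ⟨R, hR, hl⟩ := hi Y a (j ≫ b) (by simpa using h)
  choose l hl₁ hl₂ using hl
  choose S hS hk using fun Z f hf ↦ hj Z (l (Z := Z) f hf) (b ≫ G.map f.op) (by simp [hl₂])
  refine ⟨Sieve.bind R fun Z f hf ↦ S Z f hf, J.bind_covering hR fun Z f hf ↦ hS Z f hf, ?_⟩
  rintro W _ ⟨Z, g, f, hf, hg, rfl⟩
  obtain ⟨k, hk₁, hk₂⟩ := hk Z f hf g hg
  exact ⟨k, by simp [hk₁, reassoc_of% hl₁], by simp [hk₂]⟩

lemma comp_right {i : A ⟶ B} {q : G ⟶ H} (hp : HasLocalLifting J i p)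
    (hq : HasLocalLifting J i q) : HasLocalLifting J i (p ≫ q) := by
  intro Y a b h
  obtain ⟨R, hR, hl⟩ := hq Y (a ≫ p.app _) b (by simpa using h)
  choose l hl₁ hl₂ using hl
  choose S hS hk using fun Z f hf ↦ hp Z (a ≫ F.map f.op) (l (Z := Z) f hf) (by simp [hl₁])
  refine ⟨Sieve.bind R fun Z f hf ↦ S Z f hf, J.bind_covering hR fun Z f hf ↦ hS Z f hf, ?_⟩
  rintro W _ ⟨Z, g, f, hf, hg, rfl⟩
  obtain ⟨k, hk₁, hk₂⟩ := hk Z f hf g hg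
  exact ⟨k, by simp [hk₁], by simp [reassoc_of% hk₂, reassoc_of% hl₂]⟩

lemma of_isPushout {i : A ⟶ B} {j : A' ⟶ B'} {t : A ⟶ A'} {b : B ⟶ B'}
    (sq : IsPushout t i j b) (hi : HasLocalLifting J i p) : HasLocalLifting J j p := by
  intro Y a c h
  obtain ⟨R, hR, hl⟩ := hi Y (t ≫ a) (b ≫ c) (by simp [h, sq.w_assoc])
  refine ⟨R, hR, fun Z f hf ↦ ?_⟩
  obtain ⟨l, hl₁, hl₂⟩ := hl f hf
  refine ⟨sq.desc (a ≫ F.map f.op) l (by simp [hl₁]), by simp, ?_⟩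
  apply sq.hom_ext
  · simp [← reassoc_of% h]
  · simp [hl₂]

lemma of_isPullback {F' G' : SimplicialPresheaf C} {i : A ⟶ B} {p' : F' ⟶ G'} {t : F' ⟶ F}
    {b : G' ⟶ G} (sq : IsPullback t p' p b) (hp : HasLocalLifting J i p) :
    HasLocalLifting J i p' := by
  intro Y a c h
  obtain ⟨R, hR, hl⟩ := hp Y (a ≫ t.app _) (c ≫ b.app _) (by
    rw [← reassoc_of% h, Category.assoc, ← NatTrans.comp_app, ← NatTrans.comp_app, sq.w])
  refine ⟨R, hR, fun Z f hf ↦ ?_⟩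
  obtain ⟨l, hl₁, hl₂⟩ := hl f hf
  have sq' := sq.map ((evaluation _ _).obj (op Z))
  dsimp at sq'
  refine ⟨sq'.lift l (c ≫ G'.map f.op) (by simp [hl₂]), ?_, by simp⟩
  apply sq'.hom_ext
  · simp [hl₁]
  · simp [← reassoc_of% h]

/-- The summands are lifted over different covering sieves; finiteness keeps their intersection
covering. -/
lemma sigma {ι : Type u} [Finite ι] {X Y : ι → SSet.{u}} {i : ∀ k, X k ⟶ Y k}
    (hi : ∀ k, HasLocalLifting J (i k) p) : HasLocalLifting J (Limits.Sigma.map i) p := by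
  intro T a b h
  have := Fintype.ofFinite ι
  have (k : ι) := hi k T (Sigma.ι _ k ≫ a) (Sigma.ι _ k ≫ b) (by simp [h])
  choose R hR hl using this
  refine ⟨Finset.univ.inf R, ?_, fun Z f hf ↦ ?_⟩
  · exact Finset.inf_induction (J.top_mem _) (fun _ h _ h' ↦ J.intersection_covering h h')
      fun k _ ↦ hR k
  · choose l hl₁ hl₂ using fun k ↦ hl k f ((Finset.inf_le (Finset.mem_univ k) : Finset.univ.inf R ≤ R k) _ hf)
    refine ⟨Limits.Sigma.desc l, ?_, ?_⟩
    · ext k : 1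
      simp [hl₁]
    · ext k : 1
      simp [hl₂]

end HasLocalLifting

namespace IsLocalTrivialFibration

variable {J : GrothendieckTopology C} {F G H : SimplicialPresheaf C} {p : F ⟶ G}
  {A B : SSet.{u}}

-- `B` is obtained from `A` in finitely many stages, each attaching finitely many cells, so finitely
-- many refinements of the cover suffice.
open SSet in
lemma hasLocalLifting_of_mono (hp : IsLocalTrivialFibration J p) (i : A ⟶ B) [Mono i] [B.Finite] :
    HasLocalLifting J i p := by
  have h (d : ℕ) : HasLocalLifting J
      (Subcomplex.homOfLE ((skeletonOfMono i).monotone (Nat.zero_le d))) p := by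
    induction' d with d hd
    · exact HasLocalLifting.of_isIso (i := 𝟙 _)
    · have : Finite (relativeCellComplexOfMono.Cell i d) :=
        Finite.of_injective (β := B.nonDegenerate d) (fun c ↦ ⟨c.simplex, c.nonDegenerate⟩)
          (fun c c' h ↦ by ext; simpa using h)
      exact hd.comp_left (.of_isPushout (relativeCellComplexOfMono.isPushout i d)
        (.sigma fun _ ↦ hp d))
  obtain ⟨N, hN⟩ := B.hasDimensionLT_of_finite
  have hN' : skeletonOfMono i N = ⊤ := by
    rw [Subcomplex.eq_top_iff_of_hasDimensionLT _ N]
    intro d hd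
    simp [skeletonOfMono_obj_eq_top i hd]
  have : IsIso (skeletonOfMono i N).ι := by
    rw [hN']
    infer_instance
  have e : Subcomplex.range i = skeletonOfMono i 0 := by simp
  exact (HasLocalLifting.of_isIso (Subcomplex.toRange i ≫ (Subcomplex.eqToIso e).hom)).comp_left
    ((h N).comp_left (.of_isIso (skeletonOfMono i N).ι))

lemma comp {q : G ⟶ H} (hp : IsLocalTrivialFibration J p) (hq : IsLocalTrivialFibration J q) :
    IsLocalTrivialFibration J (p ≫ q) :=
  fun n ↦ (hp n).comp_right (hq n)

lemma of_isPullback {F' G' : SimplicialPresheaf C} {p' : F' ⟶ G'} {t : F' ⟶ F}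
    {b : G' ⟶ G} (sq : IsPullback t p' p b) (hp : IsLocalTrivialFibration J p) :
    IsLocalTrivialFibration J p' :=
  fun n ↦ (hp n).of_isPullback sq

lemma isLocalAcyclicFibration (hp : IsLocalTrivialFibration J p) :
    IsLocalAcyclicFibration J p := by
  refine ⟨fun n k ↦ hp.hasLocalLifting_of_mono _, fun n Y a b h ↦ ?_⟩
  obtain ⟨R, hR, hl⟩ := hp n Y a b h
  refine ⟨R, hR, fun Z f hf ↦ ?_⟩
  obtain ⟨l, hl₁, hl₂⟩ := hl f hf
  refine ⟨l, hl₁, fst _ _ ≫ b ≫ G.map f.op, ?_, ?_, ?_⟩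
  · simp [hl₂]
  · simp
  · simp

end IsLocalTrivialFibration

lemma isLocalTrivialFibration_freeResolutionπ (J : GrothendieckTopology C)
    (F : SimplicialPresheaf C) : IsLocalTrivialFibration J F.freeResolutionπ := by
  intro n Y a b h
  obtain ⟨l, hl₁, hl₂⟩ := F.freeResolutionπ_lift n Y a b h
  exact ⟨⊤, J.top_mem _, fun Z f _ ↦
    ⟨l ≫ F.freeResolution.map f.op, by simp [reassoc_of% hl₁], by simp [reassoc_of% hl₂]⟩⟩

/-! ### Discrete targets -/

/-- Homotopies in a discrete simplicial set are constant. -/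
lemma eq_fst_comp_of_discrete {L : SSet.{u}} {S : Type u}
    (H : L ⊗ Δ[1] ⟶ (SimplicialObject.const (Type u)).obj S) : H = fst _ _ ≫ SSet.ι₀ ≫ H := by
  have key (m : SimplexCategoryᵒᵖ) (x : L.obj m) (s : (Δ[1] : SSet.{u}).obj m) :
      H.app m (x, s) = H.app (op ⦋1⦌)
        (L.map (SimplexCategory.const ⦋1⦌ m.unop 0).op x, SSet.stdSimplex.objEquiv.symm (𝟙 _)) := by
    -- Restriction is the identity in a constant simplicial set, so it is enough to compare
    -- vertices: `(x, s)` and `z` share the vertex `(x₀, s 0)`, and `z` does not depend on `s`.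
    let v : ⦋0⦌ ⟶ m.unop := SimplexCategory.const ⦋0⦌ m.unop 0
    let t : ⦋0⦌ ⟶ ⦋1⦌ := v ≫ SSet.stdSimplex.objEquiv s
    let y : (L ⊗ Δ[1]).obj m := (x, s)
    let z : (L ⊗ Δ[1]).obj (op ⦋1⦌) :=
      (L.map (SimplexCategory.const ⦋1⦌ m.unop 0).op x, SSet.stdSimplex.objEquiv.symm (𝟙 _))
    refine (NatTrans.naturality_apply H v.op y).symm.trans (Eq.trans ?_
      (NatTrans.naturality_apply H t.op z))
    refine congrArg (H.app (op ⦋0⦌)) (Prod.ext ?_ ?_)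
    · change L.map v.op x = L.map t.op (L.map _ x)
      rw [← Functor.map_comp_apply]
      rfl
    · rfl
  ext m ⟨x, s⟩
  exact (key m x s).trans (key m x _).symm

lemma isLocalAcyclicFibration_iff (J : GrothendieckTopology C) {F : SimplicialPresheaf C} {X : C}
    (p : F ⟶ representable X) : IsLocalAcyclicFibration J p ↔ IsLocalTrivialFibration J p := by
  refine ⟨fun hp n Y a b h ↦ ?_, fun hp ↦ hp.isLocalAcyclicFibration⟩
  obtain ⟨R, hR, hl⟩ := hp.2 n Y a b h
  refine ⟨R, hR, fun Z f hf ↦ ?_⟩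
  obtain ⟨l, hl₁, H, h₀, h₁, _⟩ := hl f hf
  refine ⟨l, hl₁, ?_⟩
  rw [← h₀, ← h₁, eq_fst_comp_of_discrete H]
  simp

/-! ### Path spaces -/

/-- The simplicial path space functor `K ↦ K ^ Δ[1]`. -/
noncomputable abbrev pathFunctor : SSet.{u} ⥤ SSet.{u} := ihom Δ[1]

/-- The path space functor is right adjoint to the functor `- ⊗ Δ[1]`. -/
noncomputable def pathAdjunction : tensorRight (Δ[1] : SSet.{u}) ⊣ pathFunctor :=
  (ihom.adjunction _).ofNatIsoLeft (BraidedCategory.tensorLeftIsoTensorRight _)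

/-- The source of a path. -/
noncomputable def pathSource : pathFunctor.{u} ⟶ 𝟭 SSet.{u} where
  app K := SSet.ι₀ ≫ pathAdjunction.counit.app K
  naturality K L f := by
    have := pathAdjunction.counit.naturality f
    dsimp at this ⊢
    rw [Category.assoc, ← this, SSet.ι₀_comp_assoc]

/-- The target of a path. -/
noncomputable def pathTarget : pathFunctor.{u} ⟶ 𝟭 SSet.{u} where
  app K := SSet.ι₁ ≫ pathAdjunction.counit.app K
  naturality K L f := by
    have := pathAdjunction.counit.naturality f
    dsimp at this ⊢
    rw [Category.assoc, ← this, SSet.ι₁_comp_assoc]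

lemma comp_pathSource {K L : SSet.{u}} (c : K ⟶ pathFunctor.obj L) :
    c ≫ pathSource.app L = SSet.ι₀ ≫ (pathAdjunction.homEquiv K L).symm c := by
  rw [Adjunction.homEquiv_counit]
  dsimp [pathSource]
  rw [SSet.ι₀_comp_assoc]

lemma comp_pathTarget {K L : SSet.{u}} (c : K ⟶ pathFunctor.obj L) :
    c ≫ pathTarget.app L = SSet.ι₁ ≫ (pathAdjunction.homEquiv K L).symm c := by
  rw [Adjunction.homEquiv_counit]
  dsimp [pathTarget]
  rw [SSet.ι₁_comp_assoc]

/-! ### Maps out of `A × Δ[1] ∪ L × ∂Δ[1]` -/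

section

variable {L K : SSet.{u}} (A : L.Subcomplex)

/-- A non-surjective map to `⦋1⦌` is constant. Hence `L ⊗ ∂Δ[1]` is two copies of `L`, told apart by
the value at `0`. -/
lemma boundary_one_apply_eq {m : SimplexCategoryᵒᵖ} (τ : (∂Δ[1] : SSet.{u}).obj m)
    (i j : Fin (m.unop.len + 1)) :
    (SSet.stdSimplex.objEquiv τ.1).toOrderHom i = (SSet.stdSimplex.objEquiv τ.1).toOrderHom j := by
  by_contra h
  apply τ.2
  intro k
  by_cases hi : (SSet.stdSimplex.objEquiv τ.1).toOrderHom i = k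
  · exact ⟨i, hi⟩
  · refine ⟨j, ?_⟩
    change (SSet.stdSimplex.objEquiv τ.1).toOrderHom j = k
    generalize (SSet.stdSimplex.objEquiv τ.1).toOrderHom i = x at *
    generalize (SSet.stdSimplex.objEquiv τ.1).toOrderHom j = y at *
    revert h hi
    revert x y k
    change ∀ (k x y : Fin 2), _
    decide

lemma boundary_one_eq_ι₀ {m : SimplexCategoryᵒᵖ} (τ : (∂Δ[1] : SSet.{u}).obj m)
    (h : (SSet.stdSimplex.objEquiv τ.1).toOrderHom 0 = 0) (x : L.obj m) :
    ((x, τ.1) : (L ⊗ Δ[1]).obj m) = SSet.ι₀.app m x := by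
  refine Prod.ext rfl (SSet.stdSimplex.objEquiv.injective ?_)
  ext k : 3
  exact (boundary_one_apply_eq τ k 0).trans h

lemma boundary_one_eq_ι₁ {m : SimplexCategoryᵒᵖ} (τ : (∂Δ[1] : SSet.{u}).obj m)
    (h : (SSet.stdSimplex.objEquiv τ.1).toOrderHom 0 ≠ 0) (x : L.obj m) :
    ((x, τ.1) : (L ⊗ Δ[1]).obj m) = SSet.ι₁.app m x := by
  refine Prod.ext rfl (SSet.stdSimplex.objEquiv.injective ?_)
  ext k : 3
  exact (boundary_one_apply_eq τ k 0).trans (Fin.eq_one_of_ne_zero _ h)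

open Classical in
/-- The map `L ⊗ ∂Δ[1] ⟶ K` given by two maps `L ⟶ K`. -/
noncomputable def boundaryOneDesc (f g : L ⟶ K) : L ⊗ (∂Δ[1] : SSet.{u}) ⟶ K where
  app m := TypeCat.ofHom fun x ↦
    if (SSet.stdSimplex.objEquiv x.2.1).toOrderHom 0 = 0 then f.app m x.1 else g.app m x.1
  naturality m m' θ := by
    ext ⟨x, τ⟩
    have h : (SSet.stdSimplex.objEquiv ((∂Δ[1] : SSet.{u}).map θ τ).1).toOrderHom 0 =
      (SSet.stdSimplex.objEquiv τ.1).toOrderHom 0 := boundary_one_apply_eq τ _ _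
    change (if (SSet.stdSimplex.objEquiv ((∂Δ[1] : SSet.{u}).map θ τ).1).toOrderHom 0 = 0
      then f.app m' (L.map θ x) else g.app m' (L.map θ x)) = K.map θ (ite _ _ _)
    rw [h]
    split_ifs
    · exact NatTrans.naturality_apply f θ x
    · exact NatTrans.naturality_apply g θ x

lemma boundaryOneDesc_app_of_eq (f g : L ⟶ K) {m : SimplexCategoryᵒᵖ} (x : L.obj m)
    (τ : (∂Δ[1] : SSet.{u}).obj m) (h : (SSet.stdSimplex.objEquiv τ.1).toOrderHom 0 = 0) :
    (boundaryOneDesc f g).app m (x, τ) = f.app m x :=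
  if_pos h

lemma boundaryOneDesc_app_of_ne (f g : L ⟶ K) {m : SimplexCategoryᵒᵖ} (x : L.obj m)
    (τ : (∂Δ[1] : SSet.{u}).obj m) (h : (SSet.stdSimplex.objEquiv τ.1).toOrderHom 0 ≠ 0) :
    (boundaryOneDesc f g).app m (x, τ) = g.app m x :=
  if_neg h

/-- The union is a pushout along `A ⊗ ∂Δ[1]`. The map `q` is there because lifts are found only
after restriction to the members of a cover. -/
lemma exists_unionProd_desc (f g : L ⟶ K) (h : (A : SSet.{u}) ⊗ Δ[1] ⟶ K)
    (h₀ : SSet.ι₀ ≫ h = A.ι ≫ f) (h₁ : SSet.ι₁ ≫ h = A.ι ≫ g)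
    {M : SSet.{u}} (p : K ⟶ M) (c : L ⟶ M) (hf : f ≫ p = c) (hg : g ≫ p = c)
    (hh : h ≫ p = fst _ _ ≫ A.ι ≫ c) :
    ∃ H : (A.unionProd (SSet.boundary.{u} 1) : SSet.{u}) ⟶ K,
      H ≫ p = (A.unionProd (SSet.boundary.{u} 1)).ι ≫ fst _ _ ≫ c ∧
      ∀ (K' : SSet.{u}) (q : K ⟶ K') (l : L ⊗ Δ[1] ⟶ K'),
        (A.unionProd (SSet.boundary.{u} 1)).ι ≫ l = H ≫ q →
          A.ι ▷ _ ≫ l = h ≫ q ∧ SSet.ι₀ ≫ l = f ≫ q ∧ SSet.ι₁ ≫ l = g ≫ q := by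
  have sq := SSet.Subcomplex.unionProd.isPushout A (SSet.boundary.{u} 1)
  refine ⟨sq.desc (boundaryOneDesc f g) h ?_, ?_, fun K' q l hl ↦ ⟨?_, ?_, ?_⟩⟩
  · ext m ⟨x, τ⟩
    by_cases hτ : (SSet.stdSimplex.objEquiv τ.1).toOrderHom 0 = 0
    · refine (boundaryOneDesc_app_of_eq f g x.1 τ hτ).trans ?_
      refine (ConcreteCategory.congr_hom (NatTrans.congr_app h₀ m) x).symm.trans ?_
      exact congrArg (h.app m) (boundary_one_eq_ι₀ τ hτ x).symm
    · refine (boundaryOneDesc_app_of_ne f g x.1 τ hτ).trans ?_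
      refine (ConcreteCategory.congr_hom (NatTrans.congr_app h₁ m) x).symm.trans ?_
      exact congrArg (h.app m) (boundary_one_eq_ι₁ τ hτ x).symm
  · apply sq.hom_ext
    · rw [sq.inl_desc_assoc]
      ext m ⟨x, τ⟩
      by_cases hτ : (SSet.stdSimplex.objEquiv τ.1).toOrderHom 0 = 0
      · refine (congrArg (p.app m) (boundaryOneDesc_app_of_eq f g x τ hτ)).trans ?_
        exact ConcreteCategory.congr_hom (NatTrans.congr_app hf m) x
      · refine (congrArg (p.app m) (boundaryOneDesc_app_of_ne f g x τ hτ)).trans ?_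
        exact ConcreteCategory.congr_hom (NatTrans.congr_app hg m) x
    · rw [sq.inr_desc_assoc, hh]
      rfl
  · have := SSet.Subcomplex.unionProd.ι₂ A (SSet.boundary.{u} 1) ≫= hl
    rwa [sq.inr_desc_assoc] at this
  · have := SSet.Subcomplex.unionProd.ι₁ A (SSet.boundary.{u} 1) ≫= hl
    rw [sq.inl_desc_assoc] at this
    ext m x
    let τ : (∂Δ[1] : SSet.{u}).obj m := ⟨(SSet.ι₀.app m x).2, fun h ↦ by
      obtain ⟨k, hk⟩ := h 1
      exact zero_ne_one hk⟩
    refine (ConcreteCategory.congr_hom (NatTrans.congr_app this m)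
      ((x, τ) : (L ⊗ (∂Δ[1] : SSet.{u})).obj m)).trans ?_
    exact congrArg (q.app m) (boundaryOneDesc_app_of_eq f g x τ rfl)
  · have := SSet.Subcomplex.unionProd.ι₁ A (SSet.boundary.{u} 1) ≫= hl
    rw [sq.inl_desc_assoc] at this
    ext m x
    let τ : (∂Δ[1] : SSet.{u}).obj m := ⟨(SSet.ι₁.app m x).2, fun h ↦ by
      obtain ⟨k, hk⟩ := h 0
      exact one_ne_zero hk⟩
    refine (ConcreteCategory.congr_hom (NatTrans.congr_app this m)
      ((x, τ) : (L ⊗ (∂Δ[1] : SSet.{u})).obj m)).trans ?_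
    exact congrArg (q.app m) (boundaryOneDesc_app_of_ne f g x τ one_ne_zero)

end

/-! ### The object of homotopies between two maps -/

section

variable {U V : SimplicialPresheaf C} (s t : V ⟶ U)

/-- The simplicial presheaf of homotopies between two maps: its simplices are the simplices of `V`
with a path between their images by the two maps. -/
noncomputable abbrev homotopyObject : SimplicialPresheaf C :=
  pullback (lift s t)
    (lift (Functor.whiskerLeft U pathSource) (Functor.whiskerLeft U pathTarget) :
      U ⋙ pathFunctor ⟶ U ⊗ U)

/-- The projection from the simplicial presheaf of homotopies. -/
noncomputable abbrev homotopyObjectFst : homotopyObject s t ⟶ V := pullback.fst _ _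

/-- The paths given by the simplicial presheaf of homotopies. -/
noncomputable abbrev homotopyObjectSnd : homotopyObject s t ⟶ U ⋙ pathFunctor := pullback.snd _ _

lemma homotopyObject_condition₀ :
    homotopyObjectFst s t ≫ s = homotopyObjectSnd s t ≫ Functor.whiskerLeft U pathSource := by
  simpa using pullback.condition (f := lift s t) (g := lift (Functor.whiskerLeft U pathSource)
    (Functor.whiskerLeft U pathTarget)) =≫ fst _ _

lemma homotopyObject_condition₁ :
    homotopyObjectFst s t ≫ t = homotopyObjectSnd s t ≫ Functor.whiskerLeft U pathTarget := by
  simpa using pullback.condition (f := lift s t) (g := lift (Functor.whiskerLeft U pathSource)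
    (Functor.whiskerLeft U pathTarget)) =≫ snd _ _

lemma simplicialHomotopic_homotopyObjectFst {W : SimplicialPresheaf C}
    (q : W ⟶ homotopyObject s t) : SimplicialHomotopic (q ≫ homotopyObjectFst s t ≫ s)
      (q ≫ homotopyObjectFst s t ≫ t) := by
  refine ⟨Functor.whiskerRight (q ≫ homotopyObjectSnd s t) (tensorRight _) ≫
    Functor.whiskerLeft U pathAdjunction.counit, ?_, ?_⟩
  · rw [homotopyObject_condition₀]
    ext Y : 2
    have := SSet.ι₀_comp_assoc ((q ≫ homotopyObjectSnd s t).app Y)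
      (pathAdjunction.counit.app (U.obj Y))
    exact this.trans (Category.assoc _ _ _)
  · rw [homotopyObject_condition₁]
    ext Y : 2
    have := SSet.ι₁_comp_assoc ((q ≫ homotopyObjectSnd s t).app Y)
      (pathAdjunction.counit.app (U.obj Y))
    exact this.trans (Category.assoc _ _ _)

lemma exists_lift_homotopyObject {Y : C} {K : SSet.{u}} (v : K ⟶ V.obj (op Y))
    (h : K ⊗ Δ[1] ⟶ U.obj (op Y)) (h₀ : SSet.ι₀ ≫ h = v ≫ s.app _)
    (h₁ : SSet.ι₁ ≫ h = v ≫ t.app _) :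
    ∃ l : K ⟶ (homotopyObject s t).obj (op Y), l ≫ (homotopyObjectFst s t).app _ = v ∧
      l ≫ (homotopyObjectSnd s t).app _ = pathAdjunction.homEquiv _ _ h := by
  have sq := (IsPullback.of_hasPullback (lift s t) (lift (Functor.whiskerLeft U pathSource)
    (Functor.whiskerLeft U pathTarget))).map ((evaluation _ _).obj (op Y))
  refine ⟨sq.lift v (pathAdjunction.homEquiv _ _ h) ?_, sq.lift_fst _ _ _, sq.lift_snd _ _ _⟩
  apply CartesianMonoidalCategory.hom_ext
  · have := comp_pathSource (pathAdjunction.homEquiv _ _ h)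
    rw [Equiv.symm_apply_apply, h₀] at this
    exact this.symm
  · have := comp_pathTarget (pathAdjunction.homEquiv _ _ h)
    rw [Equiv.symm_apply_apply, h₁] at this
    exact this.symm

lemma hom_ext_homotopyObject {Y : C} {K : SSet.{u}} {a b : K ⟶ (homotopyObject s t).obj (op Y)}
    (h₁ : a ≫ (homotopyObjectFst s t).app _ = b ≫ (homotopyObjectFst s t).app _)
    (h₂ : a ≫ (homotopyObjectSnd s t).app _ = b ≫ (homotopyObjectSnd s t).app _) : a = b :=
  ((IsPullback.of_hasPullback (lift s t) (lift (Functor.whiskerLeft U pathSource)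
    (Functor.whiskerLeft U pathTarget))).map ((evaluation _ _).obj (op Y))).hom_ext h₁ h₂

/-- By adjunction, a square from `∂Δ[n] ⟶ Δ[n]` gives a homotopy on `∂Δ[n]` between the restrictions
of `b ≫ s` and `b ≫ t`, and a lift is an extension of it to `Δ[n]`, found locally from `hp`. -/
lemma isLocalTrivialFibration_homotopyObjectFst {J : GrothendieckTopology C} {X : C}
    {p : U ⟶ representable X} (hp : IsLocalTrivialFibration J p) (hst : s ≫ p = t ≫ p) :
    IsLocalTrivialFibration J (homotopyObjectFst s t) := by
  intro n Y a b hab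
  let h := (pathAdjunction.homEquiv _ _).symm (a ≫ (homotopyObjectSnd s t).app _)
  have h₀ : SSet.ι₀ ≫ h = (SSet.boundary.{u} n).ι ≫ b ≫ s.app _ := by
    rw [← comp_pathSource, ← reassoc_of% hab, Category.assoc]
    exact congrArg (a ≫ ·) (NatTrans.congr_app (homotopyObject_condition₀ s t) (op Y)).symm
  have h₁ : SSet.ι₁ ≫ h = (SSet.boundary.{u} n).ι ≫ b ≫ t.app _ := by
    rw [← comp_pathTarget, ← reassoc_of% hab, Category.assoc]
    exact congrArg (a ≫ ·) (NatTrans.congr_app (homotopyObject_condition₁ s t) (op Y)).symm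
  obtain ⟨H, hH, hl⟩ := exists_unionProd_desc (SSet.boundary.{u} n) (b ≫ s.app _) (b ≫ t.app _)
    h h₀ h₁ (p.app _) (b ≫ s.app _ ≫ p.app _) (by simp)
    (by
      have := NatTrans.congr_app hst (op Y)
      dsimp at this
      simp [this])
    (by
      -- The homotopy lies over `rX` automatically, by discreteness.
      rw [eq_fst_comp_of_discrete (h ≫ p.app (op Y)), reassoc_of% h₀])
  obtain ⟨R, hR, hl'⟩ := hp.hasLocalLifting_of_mono
    (SSet.Subcomplex.unionProd (SSet.boundary.{u} n) (SSet.boundary.{u} 1)).ι Y H _ hH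
  refine ⟨R, hR, fun Z f hf ↦ ?_⟩
  obtain ⟨l, hl₁, -⟩ := hl' f hf
  obtain ⟨hl₂, hl₃, hl₄⟩ := hl _ _ l hl₁
  obtain ⟨k, hk₁, hk₂⟩ := exists_lift_homotopyObject s t (b ≫ V.map f.op) l (by simp [hl₃])
    (by simp [hl₄])
  refine ⟨k, hom_ext_homotopyObject s t ?_ ?_, hk₁⟩
  · rw [Category.assoc, hk₁, Category.assoc, NatTrans.naturality, reassoc_of% hab]
  · rw [Category.assoc, hk₂, Category.assoc, NatTrans.naturality,
      ← Adjunction.homEquiv_naturality_left]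
    dsimp
    rw [hl₂, Adjunction.homEquiv_naturality_right, Equiv.apply_symm_apply, Category.assoc]

end

end CategoryTheory.SimplicialPresheaf

/-! ### Construction of the hypercovers -/

namespace CategoryTheory.SimplicialPresheaf

variable {C : Type u} [SmallCategory C] (J : GrothendieckTopology C) {X : C}

variable {J} in
/-- The hypercover given by the free resolution of a local trivial fibration. -/
noncomputable def hypercoverOfIsLocalTrivialFibration {F : SimplicialPresheaf C}
    (p : F ⟶ representable X) (hp : IsLocalTrivialFibration J p) : HC J X :=
  ⟨Over.mk (F.freeResolutionπ ≫ p), F.isCoproductOfRepresentables_freeResolution,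
    ((isLocalTrivialFibration_freeResolutionπ J F).comp hp).isLocalAcyclicFibration⟩

variable {J} in
/-- A map over `X` from a local trivial fibration to a hypercover gives a map of hypercovers. -/
noncomputable def hypercoverHom {F : SimplicialPresheaf C}
    {p : F ⟶ representable X} (hp : IsLocalTrivialFibration J p) {U : HC J X}
    (q : F ⟶ U.obj.left) (hq : q ≫ U.obj.hom = p) :
    hypercoverOfIsLocalTrivialFibration p hp ⟶ U :=
  ObjectProperty.homMk (Over.homMk (F.freeResolutionπ ≫ q)
    (by simp [hypercoverOfIsLocalTrivialFibration, hq]))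

variable {J} in
lemma isLocalTrivialFibration_hom (U : HC J X) : IsLocalTrivialFibration J U.obj.hom :=
  (isLocalAcyclicFibration_iff J _).1 U.property.2

lemma nonempty_HC : Nonempty (HC J X) :=
  ⟨hypercoverOfIsLocalTrivialFibration (𝟙 (representable X)) fun _ Y _ b h ↦
    ⟨⊤, J.top_mem _, fun Z f _ ↦ ⟨b ≫ (representable X).map f.op, by simp at h; simp [h], by simp⟩⟩⟩

variable {J} in
lemma exists_hypercover_over_pair (U V : HC J X) :
    ∃ W : HC J X, Nonempty (W ⟶ U) ∧ Nonempty (W ⟶ V) := by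
  have hp : IsLocalTrivialFibration J (pullback.snd U.obj.hom V.obj.hom ≫ V.obj.hom) :=
    (isLocalTrivialFibration_hom U).of_isPullback (IsPullback.of_hasPullback _ _) |>.comp
      (isLocalTrivialFibration_hom V)
  exact ⟨_, ⟨hypercoverHom hp (pullback.fst _ _) pullback.condition⟩,
    ⟨hypercoverHom hp (pullback.snd _ _) rfl⟩⟩

variable {J} in
lemma exists_homotopyRel_comp {U V : HC J X} (s t : V ⟶ U) :
    ∃ (W : HC J X) (q : W ⟶ V), homotopyRel J X (q ≫ s) (q ≫ t) := by
  have hs := Over.w s.hom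
  have ht := Over.w t.hom
  have hp : IsLocalTrivialFibration J (homotopyObjectFst s.hom.left t.hom.left ≫ V.obj.hom) :=
    (isLocalTrivialFibration_homotopyObjectFst _ _ (isLocalTrivialFibration_hom U)
      (hs.trans ht.symm)).comp (isLocalTrivialFibration_hom V)
  refine ⟨_, hypercoverHom hp (homotopyObjectFst s.hom.left t.hom.left) rfl, ?_⟩
  have := simplicialHomotopic_homotopyObjectFst s.hom.left t.hom.left (freeResolutionπ _)
  simp only [← Category.assoc] at this
  exact this

end CategoryTheory.SimplicialPresheaf

theorem mainTheorem11 {C : Type u} [SmallCategory C] (J : GrothendieckTopology C) (X : C) :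
    IsCofiltered (SimplicialPresheaf.PiHC J X) := by
  have := SimplicialPresheaf.nonempty_HC J (X := X)
  let π := CategoryTheory.Quotient.functor (SimplicialPresheaf.homotopyRel J X)
  exact
    { cone_objs := fun ⟨U⟩ ⟨V⟩ ↦ by
        obtain ⟨W, ⟨f⟩, ⟨g⟩⟩ := SimplicialPresheaf.exists_hypercover_over_pair U V
        exact ⟨π.obj W, π.map f, π.map g, trivial⟩
      cone_maps := fun ⟨V⟩ ⟨U⟩ s t ↦ by
        -- Any representatives will do: after refinement, a single homotopy joins them.
        obtain ⟨s, rfl⟩ := π.map_surjective (X := V) (Y := U) s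
        obtain ⟨t, rfl⟩ := π.map_surjective (X := V) (Y := U) t
        obtain ⟨W, q, h⟩ := SimplicialPresheaf.exists_homotopyRel_comp s t
        refine ⟨π.obj W, π.map q, ?_⟩
        rw [← π.map_comp, ← π.map_comp]
        exact CategoryTheory.Quotient.sound _ h
      nonempty := this.map π.obj }
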